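/- Let $X$ be a locally noetherian Grothendieck category (a Grothendieck category with a set of noetherian generators), whose objects are called modules. Let $\dim$ be a dimension function on $X$: it assigns to each module either $-1$ or an ordinal, such that (a) $\dim M=-1$ if and only if $M=0$; (b) $\dim N=\sup\{\dim M,\dim K\}$ for every short exact sequence $0\to M\to N\to K\to 0$; (c) $\dim N=\sup\{\dim N' : N'\le N \text{ noetherian}\}$; (d) for every strictly descending chain $M=M_0\supset M_1\supset\cdots$ with $M$ noetherian, $\dim M_i/M_{i+1}<\dim M$ for all but finitely many $i$. Let $\alpha$ be an ordinal and let $\mathcal C_{<\alpha}$ be the Serre subcategory of modules of dimension $<\alpha$, with quotient functor $\pi_\alpha:X\to X/\mathcal C_{<\alpha}$. If $\alpha$ is a limit ordinal, assume that $\mathcal C_{<\alpha}$ is closed under direct sums, i.e. is localizing (this is automatic for all other $\alpha$). Let $M$ be an $\alpha$-critical module, i.e. $\dim M=\alpha$ and $\dim M/N<\alpha$ for every nonzero $N\le M$. Let $\tilde M$ be the largest $\alpha$-critical submodule of an injective hull $E(M)$ of $M$ (equivalently $\tilde M\cong\omega_\alpha\pi_\alpha M$, where $\omega_\alpha$ is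 the right adjoint of $\pi_\alpha$). For a module $N$ let $\sigma[N]$ (respectively $\pi[N]$) be the smallest full subcategory of $X$ that contains $N$ and is closed under isomorphisms, subquotients and arbitrary direct sums (respectively arbitrary direct products); a full subcategory closed under isomorphisms, subquotients and arbitrary direct products is called closed. Call $M$ tiny if $S=\pi_\alpha M$ is a tiny simple object of $X/\mathcal C_{<\alpha}$, that is, $S$ is simple and $\operatorname{Hom}(\mathcal N,S)$ is finite-dimensional over the division ring $\operatorname{End}(S)$ for every noetherian object $\mathcal N$ of $X/\mathcal C_{<\alpha}$. Theorem. $M$ is tiny if and only if $\sigma[\tilde M]$ contains the direct product $\prod_{i\in I}\tilde M$ for every index set $I$. If moreover products are exact in $X$, then $M$ is tiny if and only if $\sigma[\tilde M]=\pi[\tilde M]$; equivalently, if and only if $\sigma[\tilde M]$ is closed. -/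

import Mathlib

open CategoryTheory CategoryTheory.Limits
open scoped ZeroObject

universe v u o

namespace NCSpace

/-- A category is locally noetherian if it has a (small) set of noetherian generators. -/
def LocallyNoetherian (C : Type u) [Category.{v} C] : Prop :=
  ∃ (I : Type v) (G : I → C), (∀ i, IsNoetherianObject (G i)) ∧
    (ObjectProperty.ofObj G).IsSeparating

section Subspaces

variable {C : Type u} [Category.{v} C]

/-- A full subcategory is weakly closed if it is closed under isomorphisms, (small) direct sums
and subquotients. -/
structure IsWeaklyClosed (P : ObjectProperty C) : Prop where
  iso : ∀ {A B : C}, (A ≅ B) → P A → P B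
  sub : ∀ {A B : C} (f : A ⟶ B) [Mono f], P B → P A
  quot : ∀ {A B : C} (f : A ⟶ B) [Epi f], P A → P B
  coprod : ∀ {I : Type v} (F : I → C) (c : Cofan F), IsColimit c → (∀ i, P (F i)) → P c.pt

/-- A full subcategory is closed if it is closed under isomorphisms, (small) direct products
and subquotients. -/
structure IsClosedSubspace (P : ObjectProperty C) : Prop where
  iso : ∀ {A B : C}, (A ≅ B) → P A → P B
  sub : ∀ {A B : C} (f : A ⟶ B) [Mono f], P B → P A
  quot : ∀ {A B : C} (f : A ⟶ B) [Epi f], P A → P B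
  prod : ∀ {I : Type v} (F : I → C) (c : Fan F), IsLimit c → (∀ i, P (F i)) → P c.pt

/-- `σ[M]`: the smallest weakly closed subspace containing `M`. -/
def sigma (M : C) : ObjectProperty C :=
  fun N => ∀ P : ObjectProperty C, IsWeaklyClosed P → P M → P N

/-- `π[M]`: the smallest closed subspace containing `M`. -/
def pi (M : C) : ObjectProperty C :=
  fun N => ∀ P : ObjectProperty C, IsClosedSubspace P → P M → P N

theorem isWeaklyClosed_sigma (M : C) : IsWeaklyClosed (sigma M) where
  iso e h P hP hM := hP.iso e (h P hP hM)
  sub f _ h P hP hM := hP.sub f (h P hP hM)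
  quot f _ h P hP hM := hP.quot f (h P hP hM)
  coprod F c hc h P hP hM := hP.coprod F c hc fun i => h i P hP hM

theorem isClosedSubspace_pi (M : C) : IsClosedSubspace (pi M) where
  iso e h P hP hM := hP.iso e (h P hP hM)
  sub f _ h P hP hM := hP.sub f (h P hP hM)
  quot f _ h P hP hM := hP.quot f (h P hP hM)
  prod F c hc h P hP hM := hP.prod F c hc fun i => h i P hP hM

end Subspaces

/-- An (exact, finitely partitive) dimension function. The value `⊥ : WithBot Ordinal` plays the
role of `-1`. -/
structure DimensionFunction (C : Type u) [Category.{v} C] [Abelian C] where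
  dim : C → WithBot Ordinal.{o}
  dim_eq_bot_iff : ∀ M : C, dim M = ⊥ ↔ IsZero M
  exact : ∀ S : ShortComplex C, S.ShortExact → dim S.X₂ = dim S.X₁ ⊔ dim S.X₃
  isLUB_noetherian : ∀ N : C,
    IsLUB {a | ∃ N' : Subobject N, IsNoetherianObject (N' : C) ∧ a = dim (N' : C)} (dim N)
  finitely_partitive : ∀ M : C, IsNoetherianObject M →
    ∀ (f : ℕ → Subobject M) (hf : StrictAnti f), f 0 = ⊤ →
      {n | ¬ dim (cokernel ((f (n + 1)).ofLE (f n) (hf n.lt_succ_self).le)) < dim M}.Finite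

section Critical

variable {C : Type u} [Category.{v} C] [Abelian C] (d : DimensionFunction.{v, u, o} C)
  (α : Ordinal.{o})

/-- The full subcategory `C_{<α}` of objects of dimension less than `α`. -/
def dimLT : ObjectProperty C := fun M => d.dim M < (α : WithBot Ordinal.{o})

/-- Condition that `C_{<α}` is closed under direct sums; since it is a Serre
subcategory (see below), this says that it is a localizing subcategory. -/
def DimLTClosedUnderSums : Prop :=
  ∀ {I : Type v} (F : I → C) (c : Cofan F), IsColimit c →
    (∀ i, dimLT d α (F i)) → dimLT d α c.pt

/-- `M` is `α`-critical: `dim M = α` and `dim (M / N) < α` for all nonzero `N ≤ M`. -/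
def IsCritical (M : C) : Prop :=
  d.dim M = (α : WithBot Ordinal.{o}) ∧
    ∀ N : Subobject M, N ≠ ⊥ → d.dim (cokernel N.arrow) < (α : WithBot Ordinal.{o})

instance isSerreClass_dimLT : (dimLT d α).IsSerreClass where
  exists_zero := ⟨0, isZero_zero C, by
    have h : d.dim (0 : C) = ⊥ := (d.dim_eq_bot_iff _).2 (isZero_zero C)
    simp [dimLT, h]⟩
  prop_of_mono f _ h := by
    have := d.exact (ShortComplex.mk f (cokernel.π f) (by simp))
      { exact := ShortComplex.exact_cokernel f }
    simp only [dimLT] at h ⊢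
    exact lt_of_le_of_lt (by simp [this]) h
  prop_of_epi f _ h := by
    have := d.exact (ShortComplex.mk (kernel.ι f) f (by simp))
      { exact := ShortComplex.exact_kernel f }
    simp only [dimLT] at h ⊢
    exact lt_of_le_of_lt (by simp [this]) h
  prop_X₂_of_shortExact hS h₁ h₃ := by
    simp only [dimLT] at h₁ h₃ ⊢
    rw [d.exact _ hS]
    exact max_lt h₁ h₃

/-- The quotient category `X / C_{<α}`: the localization of `X` at the morphisms whose kernel and
cokernel have dimension less than `α`. -/
abbrev QuotientCategory := (dimLT d α).isoModSerre.Localization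

/-- The quotient functor `π_α : X ⥤ X / C_{<α}`. -/
abbrev quotientFunctor : C ⥤ QuotientCategory d α := (dimLT d α).isoModSerre.Q

/-- An object `S` is tiny simple if it is simple and `Hom(N, S)` is finite-dimensional over (the
division ring) `End S`, acting by postcomposition, for every noetherian object `N`. -/
def IsTinySimple {D : Type*} [Category D] [Preadditive D] (S : D) : Prop :=
  Simple S ∧ ∀ N : D, IsNoetherianObject N → Module.Finite (End S) (N ⟶ S)

/-- `M` is tiny (with respect to `α`): `π_α M` is a tiny simple object of `X / C_{<α}`. -/
def IsTiny (M : C) : Prop := IsTinySimple ((quotientFunctor d α).obj M)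

/-- `i : M ⟶ E` is an injective hull: an essential monomorphism into an injective object. -/
structure IsInjectiveHull {M E : C} (i : M ⟶ E) : Prop where
  mono : Mono i
  injective : Injective E
  essential : ∀ N : Subobject E, N ≠ ⊥ → N ⊓ Subobject.mk i ≠ ⊥

/-- For `E` an injective hull of an `α`-critical object `M`, this is `M̃`, the largest `α`-critical
subobject of `E`, constructed as the sum of all of them. -/
noncomputable def tilde [IsGrothendieckAbelian.{v} C] (E : C) : Subobject E :=
  sSup {N : Subobject E | IsCritical d α (N : C)}

end Critical

end NCSpace

/-! Write X for M̃ and P for the class of objects of dimension < α. Then X is critical for P and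
P-local (`tilde_spec`, `isLocalFor_of_factors`), so Hom(N, X) = Hom(πN, πX). Moreover X behaves like
a simple injective object: a map A ⟶ X that vanishes on the kernel of f : A ⟶ X is a multiple of f,
and End X is a division ring. Up to isomorphism, the noetherian objects of the quotient are the
images of noetherian objects, so M is tiny iff Hom(N, X) is finite over End X for every noetherian N
(`isTinySimple_quotient_iff`).

Suppose these Hom modules are finite. A noetherian N ≤ X^I is separated by its maps to X, hence by
finitely many generators of Hom(N, X), so N embeds in some X^n. The power X^I is a quotient of a
direct sum of such N, hence lies in σ[X] (`sigma_pi_of_homFinite`).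

Conversely, let N' be the image of a noetherian N in X^Hom(N, X); every map N ⟶ X factors through
N'. If this power lies in σ[X], then N' is a quotient of a noetherian B ≤ X^n. By induction on n,
Hom(B, X) is finite, hence so are its submodule Hom(N', X) and the quotient Hom(N, X) of the latter
(`CriticalFor.homFinite_of_sigma`).

When products are exact, products of subquotients of powers of X are again such subquotients, and
X^(J) embeds in X^J; so σ[X] is closed as soon as it contains the powers of X. -/

namespace NCSpace

/-! ### Noetherian objects: quotients, extensions, covers -/

section Noetherian

theorem isNoetherianObject_of_strictMono {C : Type u} [Category.{v} C] {X : C} {α : Type*} [Preorder α] [WellFoundedGT α]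
    (f : Subobject X → α) (hf : StrictMono f) : IsNoetherianObject X :=
  ⟨hf.wellFoundedGT⟩

variable {C : Type u} [Category.{v} C] [Abelian C]

theorem exists_lift_of_comp_cokernel {X Y Z : C} (m : Y ⟶ X) [Mono m] (f : Z ⟶ X)
    (h : f ≫ cokernel.π m = 0) : ∃ g : Z ⟶ Y, g ≫ m = f :=
  ⟨Abelian.monoLift m f h, by simp⟩

theorem factors_iff_comp_cokernel {X Z : C} (U : Subobject X) (f : Z ⟶ X) :
    U.Factors f ↔ f ≫ cokernel.π U.arrow = 0 := by
  constructor
  · intro h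
    rw [← U.factorThru_arrow f h, Category.assoc, cokernel.condition, comp_zero]
  · intro h
    obtain ⟨g, rfl⟩ := exists_lift_of_comp_cokernel U.arrow f h
    exact U.factors_comp_arrow g

theorem factors_of_epi_comp {X Z W : C} (U : Subobject X) (e : W ⟶ Z) [Epi e] (f : Z ⟶ X)
    (h : U.Factors (e ≫ f)) : U.Factors f := by
  rw [factors_iff_comp_cokernel] at h ⊢
  rwa [← cancel_epi e, comp_zero, ← Category.assoc]

theorem isNoetherianObject_of_epi {X Y : C} (p : X ⟶ Y) [Epi p] [IsNoetherianObject X] :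
    IsNoetherianObject Y := by
  have key : ∀ U V : Subobject Y, (Subobject.pullback p).obj U ≤ (Subobject.pullback p).obj V →
      U ≤ V := by
    intro U V h
    have hsq := Subobject.isPullback p U
    have : Epi (Subobject.pullbackπ p U) := by
      have := hsq
      exact (MorphismProperty.epimorphisms C).of_isPullback hsq.flip (.infer_property p)
    refine Subobject.le_of_factors (factors_of_epi_comp V (Subobject.pullbackπ p U) _ ?_)
    rw [hsq.w]
    exact (pullback_factors_iff _ _ _).1 (Subobject.factors_of_le _ h
      (Subobject.factors_self _))
  refine isNoetherianObject_of_strictMono (Subobject.pullback p).obj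
    (fun U V h => lt_of_le_not_ge ((Subobject.pullback p).monotone h.le) fun h' => ?_)
  exact not_le_of_gt h (key _ _ h')

/-- By the modular law, comparable subobjects of X with the same trace on A and the same image in B
coincide. -/
theorem isNoetherianObject_of_extension {A X B : C} (f : A ⟶ X) (g : X ⟶ B)
    (hfg : ∀ {W : C} (x : W ⟶ X), x ≫ g = 0 → ∃ y, y ≫ f = x)
    [IsNoetherianObject A] [IsNoetherianObject B] : IsNoetherianObject X := by
  refine isNoetherianObject_of_strictMono (α := Subobject A × Subobject B)
    (fun U => ((Subobject.pullback f).obj U, imageSubobject (U.arrow ≫ g))) ?_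
  have mono : ∀ U V : Subobject X, U ≤ V →
      imageSubobject (U.arrow ≫ g) ≤ imageSubobject (V.arrow ≫ g) := by
    intro U V h
    refine imageSubobject_le _ (U.ofLE V h ≫ factorThruImageSubobject _) (by simp)
  intro U V h
  refine lt_of_le_not_ge ⟨(Subobject.pullback f).monotone h.le, mono _ _ h.le⟩ ?_
  rintro ⟨h₁, h₂⟩
  dsimp at h₁ h₂
  refine not_le_of_gt h (Subobject.le_of_factors ?_)
  let a : (V : C) ⟶ imageSubobject (U.arrow ≫ g) :=
    factorThruImageSubobject (V.arrow ≫ g) ≫ Subobject.ofLE _ _ h₂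
  have ha : a ≫ (imageSubobject (U.arrow ≫ g)).arrow = V.arrow ≫ g := by simp [a]
  let b := factorThruImageSubobject (U.arrow ≫ g)
  have hb : b ≫ (imageSubobject (U.arrow ≫ g)).arrow = U.arrow ≫ g := by simp [b]
  have hab : pullback.fst a b ≫ V.arrow ≫ g = pullback.snd a b ≫ U.arrow ≫ g := by
    simp only [← ha, ← hb, pullback.condition_assoc]
  refine factors_of_epi_comp U (pullback.fst a b) _ ?_
  -- On a cover of V, each point of V is compared with a point of U having the same image in B. The
  -- difference comes from A and lies in V, hence in U.
  obtain ⟨y, hy⟩ := hfg (pullback.fst a b ≫ V.arrow - pullback.snd a b ≫ U.arrow)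
    (by simp [hab])
  have hyV : V.Factors (y ≫ f) := by
    rw [hy, factors_iff_comp_cokernel]
    have : U.arrow ≫ cokernel.π V.arrow = 0 :=
      (factors_iff_comp_cokernel V U.arrow).1
        (Subobject.factors_of_le _ h.le (Subobject.factors_self U))
    simp [this]
  have hyU : U.Factors (y ≫ f) :=
    (pullback_factors_iff _ _ _).1
      (Subobject.factors_of_le _ h₁ ((pullback_factors_iff _ _ _).2 hyV))
  rw [hy] at hyU
  rw [factors_iff_comp_cokernel] at hyU ⊢
  simpa [sub_eq_zero] using hyU

instance isNoetherianObject_biprod (A B : C) [IsNoetherianObject A] [IsNoetherianObject B] :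
    IsNoetherianObject (A ⊞ B) :=
  isNoetherianObject_of_extension (biprod.inl : A ⟶ A ⊞ B) biprod.snd fun x hx =>
    ⟨x ≫ biprod.fst, by apply biprod.hom_ext <;> simp [hx]⟩

/-- If `N` is noetherian, an epimorphism `A ⟶ N` is already epi on a noetherian object. -/
theorem exists_noetherian_epi (hC : LocallyNoetherian C) {A N : C} (p : A ⟶ N) [Epi p]
    [IsNoetherianObject N] :
    ∃ (B : C) (h : B ⟶ A), IsNoetherianObject B ∧ Epi (h ≫ p) := by
  obtain ⟨I, G, hG, hsep⟩ := hC
  let S : Set (Subobject N) := {U | ∃ (B : C) (h : B ⟶ A), IsNoetherianObject B ∧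
    U = imageSubobject (h ≫ p)}
  have hS : S.Nonempty := ⟨_, 0, 0, isNoetherianObject_of_isZero (isZero_zero C), rfl⟩
  obtain ⟨U, ⟨B, h, hB, hU⟩, hmax⟩ :=
    (wellFounded_gt (α := Subobject N)).has_min S hS
  refine ⟨B, h, hB, ?_⟩
  -- U is a maximal image of a noetherian object. Adjoining a generator cannot enlarge it, so U
  -- absorbs every generator and is all of N.
  have hzero : p ≫ cokernel.π U.arrow = 0 := by
    refine hsep _ _ ?_
    rintro _ ⟨i⟩ g
    have := hG i
    let k : B ⊞ G i ⟶ A := biprod.desc h g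
    have hle : U ≤ imageSubobject (k ≫ p) := by
      rw [hU]
      exact imageSubobject_le _ (biprod.inl ≫ factorThruImageSubobject _) (by simp [k])
    have heq : imageSubobject (k ≫ p) ≤ U := by
      by_contra hn
      exact hmax _ ⟨_, k, inferInstance, rfl⟩ (lt_of_le_not_ge hle hn)
    rw [comp_zero, ← Category.assoc, ← factors_iff_comp_cokernel]
    refine Subobject.factors_of_le _ heq ?_
    have := imageSubobject_factors_comp_self (f := k ≫ p) biprod.inr
    simpa [k] using this
  have h0 : cokernel.π U.arrow = 0 := by
    rw [← cancel_epi p]; simpa using hzero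
  have hUe : Epi U.arrow := Preadditive.epi_of_cokernel_zero h0
  subst hU
  rw [← imageSubobject_arrow_comp (h ≫ p)]
  infer_instance

end Noetherian

/-! ### Coproducts, finite support and the embedding into products -/

section Coproducts

variable {C : Type u} [Category.{v} C] [Abelian C] [IsGrothendieckAbelian.{v} C]

open scoped Classical in
/-- The canonical projection from a coproduct to one of its summands. -/
noncomputable def sigmaProj {J : Type v} (F : J → C) (j : J) : ∐ F ⟶ F j :=
  Sigma.desc fun k => if h : k = j then eqToHom (congrArg F h) else 0

theorem ι_sigmaProj_self {J : Type v} (F : J → C) (j : J) :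
    Sigma.ι F j ≫ sigmaProj F j = 𝟙 _ := by
  simp [sigmaProj]

theorem ι_sigmaProj_of_ne {J : Type v} (F : J → C) {k j : J} (h : k ≠ j) :
    Sigma.ι F k ≫ sigmaProj F j = 0 := by
  simp [sigmaProj, h]

/-- A noetherian object mapping to a coproduct maps to a finite subcoproduct. -/
theorem exists_finset_factorization {J : Type v} (F : J → C) {A : C} [IsNoetherianObject A]
    (f : A ⟶ ∐ F) :
    ∃ s : Finset J, f ≫ ∑ j ∈ s, sigmaProj F j ≫ Sigma.ι F j = f := by
  classical
  let c := CoproductsFromFiniteFiltered.finiteSubcoproductsCocone F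
  have hc : IsColimit c := CoproductsFromFiniteFiltered.isColimitFiniteSubproductsCocone F
  let e (s : Finset J) : ∐ F ⟶ ∐ F := ∑ j ∈ s, sigmaProj F j ≫ Sigma.ι F j
  have he (s : Finset J) (k : J) (hk : k ∈ s) : Sigma.ι F k ≫ e s = Sigma.ι F k := by
    simp only [e, Preadditive.comp_sum]
    rw [Finset.sum_eq_single k]
    · rw [← Category.assoc, ι_sigmaProj_self, Category.id_comp]
    · intro j _ hj
      rw [← Category.assoc, ι_sigmaProj_of_ne F hj.symm, zero_comp]
    · exact fun h => (h hk).elim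
  -- K s is the part of A that f maps into the summands indexed by s. It grows with s, so a maximal
  -- K s contains all the others, and filtered exactness makes it all of A.
  let K (s : Finset J) : Subobject A := kernelSubobject (f ≫ e s - f)
  obtain ⟨_, ⟨s, rfl⟩, hs⟩ :=
    (wellFounded_gt (α := Subobject A)).has_min (Set.range K) ⟨_, ∅, rfl⟩
  refine ⟨s, ?_⟩
  have hle (t : Finset J) (hst : s ⊆ t) : K t ≤ K s := by
    by_contra hn
    refine hs _ ⟨t, rfl⟩ (lt_of_le_not_ge ?_ hn)
    refine le_kernelSubobject _ _ ?_
    have hse : e s ≫ e t = e s := by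
      simp only [e, Preadditive.sum_comp, Category.assoc]
      refine Finset.sum_congr rfl fun j hj => ?_
      have := he t j (hst hj)
      simp only [e] at this
      rw [this]
    have h0 : (K s).arrow ≫ (f ≫ e s - f) = 0 := kernelSubobject_arrow_comp _
    rw [Preadditive.comp_sub, sub_eq_zero] at h0 ⊢
    rw [← Category.assoc, ← h0]
    simp [hse]
  let q (t : Finset (Discrete J)) : (∐ fun x : t => F x.1.as) ⟶ ∐ F :=
    Sigma.desc fun x => Sigma.ι F x.1.as
  have ht (t : Finset (Discrete J)) (r : Finset J) (hr : ∀ j ∈ t, j.as ∈ r) :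
      q t ≫ e r = q t := by
    apply Sigma.hom_ext
    rintro ⟨⟨j⟩, hj⟩
    simp only [q, Sigma.ι_desc_assoc, Sigma.ι_desc]
    exact he r j (hr _ hj)
  have key {Z : C} (x : Z ⟶ A) (t : Finset (Discrete J))
      (y : Z ⟶ ∐ fun x : t => F x.1.as) (hxy : y ≫ q t = x ≫ f) : x ≫ f ≫ (e s - 𝟙 _) = 0 := by
    let t' : Finset J := t.image Discrete.as ∪ s
    have hx : x ≫ f ≫ e t' = x ≫ f := by
      rw [← Category.assoc, ← hxy, Category.assoc,
        ht t t' fun j hj => Finset.mem_union_left _ (Finset.mem_image_of_mem Discrete.as hj)]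
    have h1 : (K t').Factors x := by
      rw [kernelSubobject_factors_iff]
      simp [hx]
    have h2 := Subobject.factors_of_le _ (hle t' Finset.subset_union_right) h1
    rw [kernelSubobject_factors_iff] at h2
    simpa using h2
  have hz : f ≫ (e s - 𝟙 _) = 0 :=
    hc.pullback_zero_ext fun t => key _ t (pullback.fst _ _) pullback.condition
  simpa [sub_eq_zero] using hz

/-- The canonical morphism from a coproduct to the product. -/
noncomputable def sigmaToPi {J : Type v} (F : J → C) : ∐ F ⟶ ∏ᶜ F := Pi.lift (sigmaProj F)

theorem mono_sigmaToPi (hC : LocallyNoetherian C) {J : Type v} (F : J → C) :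
    Mono (sigmaToPi F) := by
  obtain ⟨I, G, hG, hsep⟩ := hC
  rw [hsep.mono_iff]
  rintro _ ⟨i⟩ g₁ g₂ h
  have := hG i
  obtain ⟨s, hs⟩ := exists_finset_factorization F (g₁ - g₂)
  rw [← sub_eq_zero, ← hs, Preadditive.comp_sum]
  refine Finset.sum_eq_zero fun j _ => ?_
  have := h =≫ Pi.π F j
  simp only [sigmaToPi, Category.assoc, limit.lift_π, Fan.mk_pt, Fan.mk_π_app] at this
  rw [Preadditive.sub_comp, ← Category.assoc, ← Category.assoc, this, sub_self]

end Coproducts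

/-! ### The largest subobject in a localizing class -/

section Torsion

variable {C : Type u} [Category.{v} C] [Abelian C] [IsGrothendieckAbelian.{v} C]
  (P : ObjectProperty C) [P.IsSerreClass]

/-- Closure of a class of objects under small coproducts. -/
def ClosedUnderSums : Prop :=
  ∀ {I : Type v} (F : I → C) (c : Cofan F), IsColimit c → (∀ i, P (F i)) → P c.pt

variable {P}

theorem exists_torsion (hP : ClosedUnderSums P) (K : C) :
    ∃ R : Subobject K, P (R : C) ∧ ∀ {B : C} (g : B ⟶ K), P (Abelian.image g) → R.Factors g := by
  let I := Shrink.{v} {N : Subobject K // P (N : C)}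
  let F : I → C := fun i => (((equivShrink _).symm i).1 : C)
  let p : ∐ F ⟶ K := Sigma.desc fun i => ((equivShrink _).symm i).1.arrow
  refine ⟨imageSubobject p, ?_, ?_⟩
  · refine P.prop_of_epi (factorThruImageSubobject p) ?_
    exact hP F _ (colimit.isColimit _) fun i => ((equivShrink _).symm i).2
  · intro B g hg
    let N : {N : Subobject K // P (N : C)} := ⟨Subobject.mk (Abelian.image.ι g),
      P.prop_of_iso (Subobject.underlyingIso _).symm hg⟩
    have h1 : (imageSubobject p).Factors N.1.arrow := by
      obtain ⟨i, hi⟩ := (equivShrink _).symm.surjective N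
      rw [← hi]
      have : Sigma.ι F i ≫ p = ((equivShrink _).symm i).1.arrow := by simp [p]
      rw [← this]
      exact imageSubobject_factors_comp_self (f := p) _
    have h2 : g = (Abelian.factorThruImage g ≫ (Subobject.underlyingIso _).inv) ≫ N.1.arrow := by
      simp [N]
    rw [h2]
    exact Subobject.factors_of_factors_right _ h1

end Torsion

/-! ### Direct sums of objects of dimension < α -/

section DimLT

variable {C : Type u} [Category.{v} C] [Abelian C] (d : DimensionFunction.{v, u, o} C)

variable [IsGrothendieckAbelian.{v} C]

theorem prop_of_finset_factorization (P : ObjectProperty C) [P.IsSerreClass] {J : Type v}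
    (F : J → C) (s : Finset J) (hF : ∀ i, P (F i)) {A : C} (f : A ⟶ ∐ F) [Mono f]
    (hs : f ≫ ∑ j ∈ s, sigmaProj F j ≫ Sigma.ι F j = f) : P A := by
  let Q := P.isoModSerre.Q
  have h0 : Q.map f = 0 := by
    rw [← hs, Preadditive.comp_sum, Functor.map_sum]
    refine Finset.sum_eq_zero fun j _ => ?_
    have hz := (ObjectProperty.SerreClassLocalization.isZero_obj_iff Q P (F j)).2 (hF j)
    rw [← Category.assoc, Functor.map_comp, hz.eq_of_src (Q.map (Sigma.ι F j)) 0, comp_zero]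
  have h1 := (ObjectProperty.SerreClassLocalization.map_eq_zero_iff Q P f).1 h0
  exact P.prop_of_mono (Abelian.factorThruImage f) h1

theorem dimLT_closedUnderSums (α : Ordinal.{o})
    (hα : Order.IsSuccLimit α → DimLTClosedUnderSums d α) :
    ClosedUnderSums (dimLT d α) := by
  by_cases hl : Order.IsSuccLimit α
  · exact hα hl
  intro F c hc hF
  -- For α not a limit, "< α" is a condition "≤ b", which passes to the supremum over noetherian
  -- subobjects.
  obtain ⟨b, hb⟩ : ∃ b : WithBot Ordinal.{o}, ∀ x : WithBot Ordinal.{o},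
      x < (α : WithBot Ordinal.{o}) ↔ x ≤ b := by
    rcases Ordinal.zero_or_succ_or_isSuccLimit α with rfl | ⟨β, rfl⟩ | h
    · refine ⟨⊥, fun x => ?_⟩
      induction x using WithBot.recBotCoe with
      | bot => simp
      | coe x => simp
    · refine ⟨(β : WithBot Ordinal.{o}), fun x => ?_⟩
      induction x using WithBot.recBotCoe with
      | bot => simp
      | coe x => exact WithBot.coe_lt_coe.trans (Order.lt_succ_iff.trans WithBot.coe_le_coe.symm)
    · exact (hl h).elim
  rw [dimLT, hb]
  refine (d.isLUB_noetherian c.pt).2 ?_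
  rintro _ ⟨N, hN, rfl⟩
  rw [← hb]
  let g : (N : C) ⟶ ∐ F := N.arrow ≫ (hc.coconePointUniqueUpToIso (colimit.isColimit _)).hom
  obtain ⟨s, hs⟩ := exists_finset_factorization F g
  exact prop_of_finset_factorization (dimLT d α) F s hF g hs

end DimLT

/-! ### Critical objects relative to a Serre class -/

section Critical

variable {C : Type u} [Category.{v} C] [Abelian C] (P : ObjectProperty C)

/-- `X` is critical with respect to `P`: it does not lie in `P`, but all its proper quotients do. -/
structure CriticalFor (X : C) : Prop where
  not_prop : ¬ P X
  prop_cokernel : ∀ {Y : C} (f : Y ⟶ X), f ≠ 0 → P (cokernel f)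

variable {P} [P.IsSerreClass]

theorem prop_of_prop_of_prop_cokernel {X Y : C} (f : X ⟶ Y) (h₁ : P X) (h₂ : P (cokernel f)) :
    P Y :=
  P.prop_X₂_of_exact (ShortComplex.exact_cokernel f) h₁ h₂

theorem prop_cokernel_of_comp {X Y Z : C} (f : X ⟶ Y) (g : Y ⟶ Z) (h : P (cokernel (f ≫ g))) :
    P (cokernel g) :=
  P.prop_of_epi (cokernel.map (f ≫ g) g f (𝟙 _) (by simp)) h

theorem prop_cokernel_comp {X Y Z : C} (f : X ⟶ Y) (g : Y ⟶ Z) (hf : P (cokernel f))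
    (hg : P (cokernel g)) : P (cokernel (f ≫ g)) :=
  P.epiModSerre.comp_mem f g hf hg

theorem CriticalFor.eq_zero {X Y : C} (hX : CriticalFor P X) (f : Y ⟶ X) (hY : P Y) : f = 0 := by
  by_contra hf
  exact hX.not_prop (prop_of_prop_of_prop_cokernel f hY (hX.prop_cokernel f hf))

theorem CriticalFor.of_essential {M X : C} (hM : CriticalFor P M) (m : M ⟶ X) [Mono m]
    (hm : P (cokernel m)) (hess : ∀ {Y : C} (f : Y ⟶ X), f ≠ 0 → pullback.snd f m ≠ 0) :
    CriticalFor P X where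
  not_prop h := hM.not_prop (P.prop_of_mono m h)
  prop_cokernel f hf := by
    have h1 := prop_cokernel_comp _ m (hM.prop_cokernel _ (hess f hf)) hm
    rw [← pullback.condition] at h1
    exact prop_cokernel_of_comp _ _ h1

/-- In the quotient category f becomes epi, and having image in P means becoming zero. -/
theorem prop_image_of_comp {X Y Z : C} (f : X ⟶ Y) (g : Y ⟶ Z) (hf : P (cokernel f))
    (h : P (Abelian.image (f ≫ g))) : P (Abelian.image g) := by
  have he := (ObjectProperty.SerreClassLocalization.epi_map_iff P.isoModSerre.Q P f).2 hf
  rw [← ObjectProperty.SerreClassLocalization.map_eq_zero_iff P.isoModSerre.Q P] at h ⊢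
  rwa [← cancel_epi (P.isoModSerre.Q.map f), comp_zero, ← Functor.map_comp]

theorem prop_image_of_eq_zero {X Y : C} {f : X ⟶ Y} (h : f = 0) : P (Abelian.image f) := by
  rw [← ObjectProperty.SerreClassLocalization.map_eq_zero_iff P.isoModSerre.Q P, h,
    Functor.map_zero]

theorem prop_image_of_factors {K Z : C} (R : Subobject K) (hR : P (R : C)) (f : Z ⟶ K)
    (h : R.Factors f) : P (Abelian.image f) := by
  rw [← ObjectProperty.SerreClassLocalization.map_eq_zero_iff P.isoModSerre.Q P,
    ← R.factorThru_arrow f h, Functor.map_comp]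
  have hz := (ObjectProperty.SerreClassLocalization.isZero_obj_iff P.isoModSerre.Q P _).2 hR
  rw [hz.eq_of_src (P.isoModSerre.Q.map R.arrow) 0, comp_zero]

theorem CriticalFor.prop_image {X Y Z : C} (hX : CriticalFor P X) (f : Y ⟶ X) (hf : f ≠ 0)
    (g : X ⟶ Z) (hfg : f ≫ g = 0) : P (Abelian.image g) :=
  prop_image_of_comp f g (hX.prop_cokernel f hf) (prop_image_of_eq_zero hfg)

end Critical

/-! ### Description of M̃ inside the injective hull -/

section Dim

variable {C : Type u} [Category.{v} C] [Abelian C] {d : DimensionFunction.{v, u, o} C}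
  {α : Ordinal.{o}}

theorem IsCritical.criticalFor {X : C} (h : IsCritical d α X) : CriticalFor (dimLT d α) X where
  not_prop := by simp [dimLT, h.1]
  prop_cokernel f hf := by
    have hN : imageSubobject f ≠ ⊥ := by
      intro h0
      apply hf
      have := imageSubobject_factors_comp_self (f := f) (𝟙 _)
      rwa [h0, Subobject.bot_factors_iff_zero, Category.id_comp] at this
    have h1 := prop_cokernel_comp (P := dimLT d α) (factorThruImageSubobject f) _
      ((dimLT d α).prop_of_isZero (isZero_cokernel_of_epi _)) (h.2 _ hN)
    rwa [imageSubobject_arrow_comp] at h1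

theorem CriticalFor.isCritical {X : C} (h : CriticalFor (dimLT d α) X)
    (hX : d.dim X = (α : WithBot Ordinal.{o})) : IsCritical d α X :=
  ⟨hX, fun N hN => h.prop_cokernel _ fun h0 => hN (by
    rw [← Subobject.mk_arrow N]
    exact (Subobject.mk_eq_bot_iff_zero).2 h0)⟩

theorem IsInjectiveHull.pullback_snd_ne_zero {M E : C} {i : M ⟶ E} (hi : IsInjectiveHull i)
    {Y : C} (f : Y ⟶ E) (hf : f ≠ 0) : pullback.snd f i ≠ 0 := by
  have := hi.mono
  intro h0
  have hN : imageSubobject f ≠ ⊥ := by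
    intro h0
    apply hf
    have := imageSubobject_factors_comp_self (f := f) (𝟙 _)
    rwa [h0, Subobject.bot_factors_iff_zero, Category.id_comp] at this
  apply hi.essential _ hN
  let V := imageSubobject f ⊓ Subobject.mk i
  have h1 : (imageSubobject f).Factors V.arrow :=
    Subobject.factors_of_le _ inf_le_left (Subobject.factors_self V)
  have h2 : (Subobject.mk i).Factors V.arrow :=
    Subobject.factors_of_le _ inf_le_right (Subobject.factors_self V)
  rw [Subobject.mk_factors_iff] at h2
  obtain ⟨b, hb⟩ : ∃ b : (V : C) ⟶ M, b ≫ i = V.arrow := h2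
  let c := (imageSubobject f).factorThru _ h1
  let e := factorThruImageSubobject f
  have hw : pullback.snd c e ≫ f = (pullback.fst c e ≫ b) ≫ i := by
    rw [Category.assoc, hb, ← Subobject.factorThru_arrow _ _ h1, pullback.condition_assoc,
      imageSubobject_arrow_comp]
  have h3 : pullback.fst c e ≫ b = 0 := by
    rw [← pullback.lift_snd _ _ hw, h0, comp_zero]
  have h4 : V.arrow = 0 := by
    rw [← cancel_epi (pullback.fst c e), ← hb, comp_zero, ← Category.assoc, h3, zero_comp]
  change V = ⊥
  rw [← Subobject.mk_arrow V]
  exact (Subobject.mk_eq_bot_iff_zero).2 h4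

variable [IsGrothendieckAbelian.{v} C]

/-- M̃ is the preimage in E of the largest P-subobject of E/M. This explicit form gives both
criticality and the saturation property used for locality. -/
theorem tilde_spec (hsum : ClosedUnderSums (dimLT d α)) {M E : C} (hM : IsCritical d α M)
    {i : M ⟶ E} (hi : IsInjectiveHull i) :
    CriticalFor (dimLT d α) (tilde d α E : C) ∧
    (∃ m : M ⟶ (tilde d α E : C), m ≫ (tilde d α E).arrow = i ∧ dimLT d α (cokernel m)) ∧
    ∀ {A B : C} (f : A ⟶ B), dimLT d α (cokernel f) → ∀ k : B ⟶ E,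
      (tilde d α E).Factors (f ≫ k) → (tilde d α E).Factors k := by
  have := hi.mono
  obtain ⟨R, hR, hR'⟩ := exists_torsion hsum (cokernel i)
  let U := (Subobject.pullback (cokernel.π i)).obj R
  have hU {Z : C} (x : Z ⟶ E) : U.Factors x ↔ dimLT d α (Abelian.image (x ≫ cokernel.π i)) := by
    rw [pullback_factors_iff]
    exact ⟨prop_image_of_factors R hR _, hR' _⟩
  have hiU : U.Factors i := (hU i).2 (prop_image_of_eq_zero (by simp))
  let m := U.factorThru i hiU
  have hm : m ≫ U.arrow = i := U.factorThru_arrow i hiU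
  have : Mono m := mono_of_mono_fac hm
  have hcm : dimLT d α (cokernel m) := by
    let S := ShortComplex.mk m (U.arrow ≫ cokernel.π i) (by rw [← Category.assoc, hm]; simp)
    have hS : S.Exact := by
      refine ShortComplex.exact_of_f_is_kernel _ (KernelFork.IsLimit.ofι' _ _ fun {W} x hx => ?_)
      have h1 : (x ≫ U.arrow) ≫ cokernel.π i = 0 := by simpa [S] using hx
      refine ⟨Abelian.monoLift i _ h1, ?_⟩
      rw [← cancel_mono U.arrow, Category.assoc, hm]
      simp
    have := hS.mono_cokernelDesc
    rw [← ObjectProperty.SerreClassLocalization.map_comp_eq_zero_iff_of_epi_mono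
      (dimLT d α).isoModSerre.Q (dimLT d α) (cokernel.π m) (cokernel.desc S.f S.g S.zero),
      ← Functor.map_comp, cokernel.π_desc,
      ObjectProperty.SerreClassLocalization.map_eq_zero_iff _ (dimLT d α)]
    exact (hU U.arrow).1 U.factors_self
  have hcrit : CriticalFor (dimLT d α) (U : C) := by
    refine hM.criticalFor.of_essential m hcm fun {Y} f hf h0 => ?_
    refine hi.pullback_snd_ne_zero (f ≫ U.arrow)
      (fun h => hf (by rwa [← cancel_mono U.arrow, zero_comp])) ?_
    have hw : pullback.fst (f ≫ U.arrow) i ≫ f = pullback.snd (f ≫ U.arrow) i ≫ m := by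
      rw [← cancel_mono U.arrow, Category.assoc, Category.assoc, hm, pullback.condition]
    rw [← pullback.lift_snd _ _ hw, h0, comp_zero]
  have hdim : d.dim (U : C) = (α : WithBot Ordinal.{o}) := by
    have := d.exact (ShortComplex.mk m (cokernel.π m) (by simp))
      { exact := ShortComplex.exact_cokernel m }
    have h2 : d.dim (cokernel m) < α := hcm
    simp only [hM.1] at this
    rw [this, max_eq_left h2.le]
  have htilde : tilde d α E = U := by
    refine le_antisymm (sSup_le fun N hN => Subobject.le_of_factors ?_)
      (le_sSup (hcrit.isCritical hdim))
    have hNc := IsCritical.criticalFor hN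
    rw [hU]
    -- A critical N ≤ E meets M nontrivially, so N ⟶ E/M kills a nonzero subobject and has image in
    -- P.
    refine hNc.prop_image (pullback.fst N.arrow i) (fun h0 => ?_) _ ?_
    · refine hi.pullback_snd_ne_zero N.arrow (fun h => hNc.not_prop ?_) ?_
      · refine (dimLT d α).prop_of_isZero ((IsZero.iff_id_eq_zero _).2 ?_)
        rw [← cancel_mono N.arrow, h, comp_zero, comp_zero]
      · rw [← cancel_mono i, ← pullback.condition, h0, zero_comp, zero_comp]
    · rw [← Category.assoc, pullback.condition]
      simp
  rw [htilde]
  refine ⟨hcrit, ⟨m, hm, hcm⟩, fun f hf k hk => ?_⟩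
  rw [hU] at hk ⊢
  rw [Category.assoc] at hk
  exact prop_image_of_comp f _ hf hk

end Dim

/-! ### Locality of saturated critical subobjects of injectives -/

section Local

variable {C : Type u} [Category.{v} C] [Abelian C]

/-- `X` is local with respect to the isomorphisms modulo the Serre class `P`. -/
def IsLocalFor (P : ObjectProperty C) [P.IsSerreClass] (X : C) : Prop :=
  ∀ {A B : C} (f : A ⟶ B), P.isoModSerre f → ∀ h : A ⟶ X, ∃ k : B ⟶ X, f ≫ k = h

/-- A map to U kills ker f, as U has no nonzero subobject in P. It thus descends to the image of f,
extends to B with values in E by injectivity, and lands in U by saturation. -/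
theorem isLocalFor_of_factors {P : ObjectProperty C} [P.IsSerreClass] {E : C} [Injective E]
    (U : Subobject E) (hU : CriticalFor P (U : C))
    (hfac : ∀ {A B : C} (f : A ⟶ B), P (cokernel f) → ∀ k : B ⟶ E,
      U.Factors (f ≫ k) → U.Factors k) : IsLocalFor P (U : C) := by
  intro A B f hf h
  have h1 : kernel.ι f ≫ h = 0 := hU.eq_zero _ hf.1
  have h0 : kernel.ι (Abelian.factorThruImage f) ≫ f = 0 := by
    have := kernel.condition (Abelian.factorThruImage f) =≫ Abelian.image.ι f
    rwa [Category.assoc, Abelian.image.fac, zero_comp] at this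
  have h2 : kernel.ι (Abelian.factorThruImage f) ≫ h = 0 := by
    rw [← kernel.lift_ι f _ h0, Category.assoc, h1, comp_zero]
  let h' := Abelian.epiDesc (Abelian.factorThruImage f) h h2
  have hh' : Abelian.factorThruImage f ≫ h' = h := by simp [h']
  let k := Injective.factorThru (h' ≫ U.arrow) (Abelian.image.ι f)
  have hk : f ≫ k = h ≫ U.arrow := by
    rw [← hh', Category.assoc, ← Injective.comp_factorThru (h' ≫ U.arrow) (Abelian.image.ι f),
      ← Category.assoc, Abelian.image.fac]
  have hkU : U.Factors k := hfac f hf.2 k (by rw [hk]; exact U.factors_comp_arrow h)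
  refine ⟨U.factorThru k hkU, ?_⟩
  rw [← cancel_mono U.arrow, Category.assoc, U.factorThru_arrow, hk]

end Local

/-! ### Finiteness of Hom over the endomorphism ring -/

section HomFinite

variable {C : Type*} [Category C] [Preadditive C]

/-- `Hom(N, S)` is finitely generated over `End S`, spelled out. -/
def HomFinite (N S : C) : Prop :=
  ∃ (n : ℕ) (g : Fin n → (N ⟶ S)), ∀ f : N ⟶ S, ∃ c : Fin n → (S ⟶ S), f = ∑ i, g i ≫ c i

theorem homFinite_iff (N S : C) : HomFinite N S ↔ Module.Finite (End S) (N ⟶ S) := by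
  rw [Module.finite_def, Submodule.fg_iff_exists_fin_generating_family]
  refine exists_congr fun n => exists_congr fun g => ?_
  rw [eq_top_iff, SetLike.le_def]
  simp only [Submodule.mem_top, forall_const, Submodule.mem_span_range_iff_exists_fun]
  exact ⟨fun h f => (h f).imp fun c hc => hc.symm, fun h f => (@h f).imp fun c hc => hc.symm⟩

theorem HomFinite.of_iso {N N' S S' : C} (h : HomFinite N S) (e : N ≅ N') (e' : S ≅ S') :
    HomFinite N' S' := by
  obtain ⟨n, g, hg⟩ := h
  refine ⟨n, fun i => e.inv ≫ g i ≫ e'.hom, fun f => ?_⟩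
  obtain ⟨c, hc⟩ := hg (e.hom ≫ f ≫ e'.inv)
  refine ⟨fun i => e'.inv ≫ c i ≫ e'.hom, ?_⟩
  have : f = e.inv ≫ (e.hom ≫ f ≫ e'.inv) ≫ e'.hom := by simp
  rw [this, hc]
  simp [Preadditive.comp_sum, Preadditive.sum_comp]

theorem IsTinySimple.of_iso {S S' : C} (h : IsTinySimple S) (e : S ≅ S') : IsTinySimple S' := by
  have := h.1
  refine ⟨Simple.of_iso e.symm, fun N hN => ?_⟩
  rw [← homFinite_iff]
  exact ((homFinite_iff _ _).2 (h.2 N hN)).of_iso (Iso.refl _) e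

theorem homFinite_map_iff {D : Type*} [Category D] [Preadditive D] (L : C ⥤ D) [L.Additive]
    {N X : C} (hN : Function.Bijective (L.map : (N ⟶ X) → _))
    (hX : Function.Bijective (L.map : (X ⟶ X) → _)) :
    HomFinite (L.obj N) (L.obj X) ↔ HomFinite N X := by
  constructor
  · rintro ⟨n, g, hg⟩
    choose g' hg' using fun i => hN.2 (g i)
    refine ⟨n, g', fun f => ?_⟩
    obtain ⟨c, hc⟩ := hg (L.map f)
    choose c' hc' using fun i => hX.2 (c i)
    refine ⟨c', hN.1 ?_⟩
    simp [hc, hg', hc', Functor.map_sum]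
  · rintro ⟨n, g, hg⟩
    refine ⟨n, fun i => L.map (g i), fun f => ?_⟩
    obtain ⟨f, rfl⟩ := hN.2 f
    obtain ⟨c, hc⟩ := hg f
    refine ⟨fun i => L.map (c i), ?_⟩
    conv_lhs => rw [hc]
    simp [Functor.map_sum]

end HomFinite

/-! ### Passage to the quotient category -/

section Quotient

open ObjectProperty.SerreClassLocalization

variable {C : Type u} [Category.{v} C] [Abelian C] {P : ObjectProperty C} [P.IsSerreClass]

theorem bijective_map_of_isLocalFor {X : C} (hX : CriticalFor P X) (hloc : IsLocalFor P X)
    (N : C) : Function.Bijective (P.isoModSerre.Q.map : (N ⟶ X) → _) := by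
  let L := P.isoModSerre.Q
  constructor
  · intro f g h
    have h1 : L.map (f - g) = 0 := by rw [Functor.map_sub, sub_eq_zero]; exact h
    rw [map_eq_zero_iff L P] at h1
    rw [← sub_eq_zero, ← Abelian.image.fac (f - g), hX.eq_zero (Abelian.image.ι (f - g)) h1,
      comp_zero]
  · intro g
    obtain ⟨φ, hφ⟩ := Localization.exists_rightFraction L P.isoModSerre g
    obtain ⟨k, hk⟩ := hloc φ.s φ.hs φ.f
    have := Localization.inverts L P.isoModSerre φ.s φ.hs
    refine ⟨k, ?_⟩
    rw [← cancel_epi (L.map φ.s), ← Functor.map_comp, hk, hφ,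
      MorphismProperty.RightFraction.map_s_comp_map]

theorem exists_map_eq_comp {Y : P.isoModSerre.Localization} {N : C}
    (y : Y ⟶ P.isoModSerre.Q.obj N) :
    ∃ (Z : C) (f : Z ⟶ N) (e : P.isoModSerre.Q.obj Z ≅ Y), P.isoModSerre.Q.map f = e.hom ≫ y := by
  let L := P.isoModSerre.Q
  have := Localization.essSurj L P.isoModSerre
  obtain ⟨φ, hφ⟩ := Localization.exists_rightFraction L P.isoModSerre
    ((L.objObjPreimageIso Y).hom ≫ y)
  have := Localization.inverts L P.isoModSerre φ.s φ.hs
  refine ⟨_, φ.f, asIso (L.map φ.s) ≪≫ L.objObjPreimageIso Y, ?_⟩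
  rw [Iso.trans_hom, Category.assoc, hφ, asIso_hom,
    MorphismProperty.RightFraction.map_s_comp_map]

theorem exists_map_eq_comp' {Y : P.isoModSerre.Localization} {N : C}
    (y : P.isoModSerre.Q.obj N ⟶ Y) :
    ∃ (Z : C) (f : N ⟶ Z) (e : Y ≅ P.isoModSerre.Q.obj Z), P.isoModSerre.Q.map f = y ≫ e.hom := by
  let L := P.isoModSerre.Q
  have := Localization.essSurj L P.isoModSerre
  obtain ⟨φ, hφ⟩ := Localization.exists_leftFraction L P.isoModSerre
    (y ≫ (L.objObjPreimageIso Y).inv)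
  have := Localization.inverts L P.isoModSerre φ.s φ.hs
  refine ⟨_, φ.f, (L.objObjPreimageIso Y).symm ≪≫ asIso (L.map φ.s), ?_⟩
  rw [Iso.trans_hom, ← Category.assoc, Iso.symm_hom, hφ, asIso_hom,
    MorphismProperty.LeftFraction.map_comp_map_s]

theorem simple_quotient_of_criticalFor {X : C} (hX : CriticalFor P X) :
    Simple (P.isoModSerre.Q.obj X) := by
  let L := P.isoModSerre.Q
  let _ : Abelian P.isoModSerre.Localization := abelian L P
  refine ⟨fun {Y} y _ => ⟨fun _ h0 => ?_, fun hy => ?_⟩⟩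
  · subst h0
    refine hX.not_prop ((isZero_obj_iff L P X).1 ((IsZero.iff_id_eq_zero _).2 ?_))
    rw [← IsIso.inv_hom_id (0 : Y ⟶ L.obj X), comp_zero]
  · obtain ⟨Z, f, e, hf⟩ := exists_map_eq_comp y
    have hf0 : f ≠ 0 := by
      rintro rfl
      apply hy
      rw [← cancel_epi e.hom, ← hf, Functor.map_zero, comp_zero]
    have h1 : Epi (L.map f) := (epi_map_iff L P f).2 (hX.prop_cokernel f hf0)
    have h2 : Epi (e.hom ≫ y) := by rw [← hf]; exact h1
    have h3 : Epi y := epi_of_epi e.hom y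
    exact isIso_of_mono_of_epi y

variable [IsGrothendieckAbelian.{v} C]

/-- The cokernel of U is represented by some N ⟶ D, and V is the preimage of the largest P-subobject
of D. Since V determines U, the quotient functor preserves noetherian objects. -/
theorem exists_subobject_factors_iff (hsum : ClosedUnderSums P) {N : C}
    (U : Subobject (P.isoModSerre.Q.obj N)) :
    ∃ V : Subobject N, ∀ {Z : C} (y : Z ⟶ N), V.Factors y ↔ U.Factors (P.isoModSerre.Q.map y) := by
  let L := P.isoModSerre.Q
  let _ : Abelian P.isoModSerre.Localization := abelian L P
  obtain ⟨D, g, e, hg⟩ := exists_map_eq_comp' (cokernel.π U.arrow)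
  obtain ⟨R, hR, hR'⟩ := exists_torsion hsum D
  refine ⟨(Subobject.pullback g).obj R, fun y => ?_⟩
  rw [pullback_factors_iff, factors_iff_comp_cokernel U]
  have h1 : R.Factors (y ≫ g) ↔ P (Abelian.image (y ≫ g)) :=
    ⟨prop_image_of_factors R hR _, hR' _⟩
  rw [h1, ← map_eq_zero_iff L P, Functor.map_comp, hg, ← Category.assoc]
  constructor
  · intro h
    rwa [← cancel_mono e.hom, zero_comp]
  · intro h
    rw [h, zero_comp]

theorem isNoetherianObject_quotient (hsum : ClosedUnderSums P) (N : C) [IsNoetherianObject N] :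
    IsNoetherianObject (P.isoModSerre.Q.obj N) := by
  let L := P.isoModSerre.Q
  let _ : Abelian P.isoModSerre.Localization := abelian L P
  choose G hG using fun U : Subobject (L.obj N) => exists_subobject_factors_iff hsum U
  refine isNoetherianObject_of_strictMono G fun U U' h => lt_of_le_not_ge ?_ fun h' => ?_
  · refine Subobject.le_of_factors ((hG U' _).2 (Subobject.factors_of_le _ h.le ?_))
    exact (hG U _).1 (Subobject.factors_self _)
  · refine not_le_of_gt h (Subobject.le_of_factors ?_)
    obtain ⟨Z, f, e, hf⟩ := exists_map_eq_comp U'.arrow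
    refine factors_of_epi_comp U e.hom _ ?_
    rw [← hf, ← hG U]
    refine Subobject.factors_of_le _ h' ((hG U' _).2 ?_)
    rw [hf]
    exact U'.factors_comp_arrow e.hom

theorem exists_noetherian_iso_quotient (hC : LocallyNoetherian C) (hsum : ClosedUnderSums P)
    (Y : P.isoModSerre.Localization) [IsNoetherianObject Y] :
    ∃ N : C, IsNoetherianObject N ∧ Nonempty (P.isoModSerre.Q.obj N ≅ Y) := by
  obtain ⟨I, G, hG, hsep⟩ := hC
  let L := P.isoModSerre.Q
  let _ : Abelian P.isoModSerre.Localization := abelian L P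
  have := Localization.essSurj L P.isoModSerre
  let N := L.objPreimage Y
  let e₀ : L.obj N ≅ Y := L.objObjPreimageIso Y
  have : IsNoetherianObject (L.obj N) := isNoetherianObject_of_mono e₀.hom
  let S : Set (Subobject (L.obj N)) := {U | ∃ (B : C) (h : B ⟶ N), IsNoetherianObject B ∧
    U = imageSubobject (L.map h)}
  have hS : S.Nonempty := ⟨_, 0, 0, isNoetherianObject_of_isZero (isZero_zero C), rfl⟩
  obtain ⟨U, ⟨B, h, hB, hU⟩, hmax⟩ :=
    (wellFounded_gt (α := Subobject (L.obj N))).has_min S hS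
  have hUz : U.arrow ≫ L.map (cokernel.π h) = 0 := by
    subst hU
    rw [← cancel_epi (factorThruImageSubobject (L.map h)), imageSubobject_arrow_comp_assoc,
      comp_zero, ← Functor.map_comp, cokernel.condition, Functor.map_zero]
  obtain ⟨R, hR, hR'⟩ := exists_torsion hsum (cokernel h)
  -- By maximality of U, each generator maps into U in the quotient category, hence into the P-part
  -- R of coker h. So coker h lies in P, and the image of h represents Y.
  have hzero : cokernel.π h ≫ cokernel.π R.arrow = 0 := by
    refine hsep _ _ ?_
    rintro _ ⟨i⟩ g
    have := hG i
    let k : B ⊞ G i ⟶ N := biprod.desc h g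
    have hle : U ≤ imageSubobject (L.map k) := by
      rw [hU]
      exact imageSubobject_le _ (L.map biprod.inl ≫ factorThruImageSubobject _) (by
        rw [Category.assoc, imageSubobject_arrow_comp, ← Functor.map_comp, biprod.inl_desc])
    have heq : imageSubobject (L.map k) ≤ U := by
      by_contra hn
      exact hmax _ ⟨_, k, inferInstance, rfl⟩ (lt_of_le_not_ge hle hn)
    rw [comp_zero, ← Category.assoc, ← factors_iff_comp_cokernel]
    apply hR'
    rw [← map_eq_zero_iff L P, Functor.map_comp]
    have h1 : U.Factors (L.map g) := by
      refine Subobject.factors_of_le _ heq ?_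
      have := imageSubobject_factors_comp_self (f := L.map k) (L.map biprod.inr)
      rwa [← Functor.map_comp, biprod.inr_desc] at this
    rw [← U.factorThru_arrow _ h1, Category.assoc, hUz, comp_zero]
  have h0 : cokernel.π R.arrow = 0 := by rw [← cancel_epi (cokernel.π h), hzero, comp_zero]
  have hRe : Epi R.arrow := Preadditive.epi_of_cokernel_zero h0
  have hcok : P.epiModSerre h := P.prop_of_epi R.arrow hR
  have := Localization.inverts L P.isoModSerre _ hcok.isoModSerre_image_ι
  exact ⟨Abelian.image h, isNoetherianObject_of_epi (Abelian.factorThruImage h),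
    ⟨asIso (L.map (Abelian.image.ι h)) ≪≫ e₀⟩⟩

theorem isTinySimple_quotient_iff (hC : LocallyNoetherian C) (hsum : ClosedUnderSums P) {X : C}
    (hX : CriticalFor P X) (hloc : IsLocalFor P X) :
    IsTinySimple (P.isoModSerre.Q.obj X) ↔ ∀ N : C, IsNoetherianObject N → HomFinite N X := by
  have hb := bijective_map_of_isLocalFor hX hloc
  constructor
  · intro h N hN
    rw [← homFinite_map_iff P.isoModSerre.Q (hb N) (hb X), homFinite_iff]
    exact h.2 _ (isNoetherianObject_quotient hsum N)
  · intro h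
    refine ⟨simple_quotient_of_criticalFor hX, fun Y hY => ?_⟩
    obtain ⟨N, hN, ⟨e⟩⟩ := exists_noetherian_iso_quotient hC hsum Y
    rw [← homFinite_iff]
    exact ((homFinite_map_iff P.isoModSerre.Q (hb N) (hb X)).2 (h N hN)).of_iso e (Iso.refl _)

end Quotient

/-! ### Structure of σ[X] and its comparison with π[X] -/

section Sigma

variable {C : Type u} [Category.{v} C]

/-- `N` is a subquotient of `Y`. -/
def IsSubquotient (N Y : C) : Prop :=
  ∃ (A : C) (a : A ⟶ Y) (e : A ⟶ N), Mono a ∧ Epi e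

theorem IsSubquotient.of_mono_target {N Y Y' : C} (h : IsSubquotient N Y) (f : Y ⟶ Y') [Mono f] :
    IsSubquotient N Y' := by
  obtain ⟨A, a, e, _, he⟩ := h
  exact ⟨A, a ≫ f, e, inferInstance, he⟩

theorem IsSubquotient.quot {N N' Y : C} (h : IsSubquotient N Y) (f : N ⟶ N') [Epi f] :
    IsSubquotient N' Y := by
  obtain ⟨A, a, e, ha, _⟩ := h
  exact ⟨A, a, e ≫ f, ha, inferInstance⟩

theorem IsWeaklyClosed.of_isSubquotient {P : ObjectProperty C} (hP : IsWeaklyClosed P) {N Y : C}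
    (h : IsSubquotient N Y) (hY : P Y) : P N := by
  obtain ⟨A, a, e, _, _⟩ := h
  exact hP.quot e (hP.sub a hY)

theorem sigma_self (X : C) : sigma X X := fun _ _ h => h

variable [Abelian C]

theorem IsSubquotient.sub {N N' Y : C} (h : IsSubquotient N Y) (f : N' ⟶ N) [Mono f] :
    IsSubquotient N' Y := by
  obtain ⟨A, a, e, _, _⟩ := h
  exact ⟨pullback e f, pullback.fst e f ≫ a, pullback.snd e f, inferInstance, inferInstance⟩

variable [IsGrothendieckAbelian.{v} C]

theorem isWeaklyClosed_subquotients (X : C) :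
    IsWeaklyClosed (fun N : C => ∃ J : Type v, IsSubquotient N (∐ fun _ : J => X)) where
  iso e := fun ⟨J, h⟩ => ⟨J, h.quot e.hom⟩
  sub f _ := fun ⟨J, h⟩ => ⟨J, h.sub f⟩
  quot f _ := fun ⟨J, h⟩ => ⟨J, h.quot f⟩
  coprod {I} F c hc h := by
    choose J A a e ha he using h
    let t := (hc.coconePointUniqueUpToIso (colimit.isColimit _)).symm
    refine ⟨Σ i, J i, ∐ A, Limits.Sigma.map a ≫ (sigmaSigmaIso J fun _ _ => X).hom,
      Limits.Sigma.map e ≫ t.hom, ?_, ?_⟩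
    · infer_instance
    · infer_instance

theorem sigma_iff (X N : C) :
    sigma X N ↔ ∃ J : Type v, IsSubquotient N (∐ fun _ : J => X) := by
  constructor
  · intro h
    refine h _ (isWeaklyClosed_subquotients X) ⟨PUnit, X, Sigma.ι (fun _ : PUnit => X) ⟨⟩, 𝟙 X,
      inferInstance, inferInstance⟩
  · rintro ⟨J, h⟩
    have hs := isWeaklyClosed_sigma X
    exact hs.of_isSubquotient h (hs.coprod _ _ (colimit.isColimit _) fun _ => sigma_self X)

theorem isClosedSubspace_sigma (hC : LocallyNoetherian C) [AB4StarOfSize.{v} C] (X : C)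
    (h : ∀ I : Type v, sigma X (∏ᶜ fun _ : I => X)) : IsClosedSubspace (sigma X) := by
  have hs := isWeaklyClosed_sigma X
  refine ⟨hs.iso, hs.sub, hs.quot, fun {I} F c hc hF => ?_⟩
  simp only [sigma_iff] at hF
  choose J hF using hF
  have hF' (i : I) : IsSubquotient (F i) (∏ᶜ fun _ : J i => X) :=
    have := mono_sigmaToPi hC fun _ : J i => X
    (hF i).of_mono_target (sigmaToPi _)
  choose A a e ha he using hF'
  let t := (hc.conePointUniqueUpToIso (limit.isLimit _)).symm
  have : Epi (Limits.Pi.map e) := by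
    let τ : Discrete.functor A ⟶ Discrete.functor F := Discrete.natTrans fun i => e i.as
    have : ∀ i, Epi (τ.app i) := fun i => he i.as
    have : Epi τ := NatTrans.epi_of_epi_app τ
    exact inferInstanceAs (Epi (lim.map τ))
  exact hs.of_isSubquotient ⟨∏ᶜ A, Limits.Pi.map a ≫ (piPiIso J fun _ _ => X).hom,
    Limits.Pi.map e ≫ t.hom, inferInstance, inferInstance⟩ (h _)

theorem IsClosedSubspace.isWeaklyClosed (hC : LocallyNoetherian C) {P : ObjectProperty C}
    (hP : IsClosedSubspace P) : IsWeaklyClosed P where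
  iso := hP.iso
  sub := hP.sub
  quot := hP.quot
  coprod F c hc hF := by
    have := mono_sigmaToPi hC F
    exact hP.sub ((hc.coconePointUniqueUpToIso (colimit.isColimit _)).hom ≫ sigmaToPi F)
      (hP.prod _ _ (limit.isLimit _) hF)

theorem sigma_eq_pi_iff (hC : LocallyNoetherian C) (X : C) :
    sigma X = pi X ↔ IsClosedSubspace (sigma X) := by
  constructor
  · intro h
    rw [h]
    exact isClosedSubspace_pi X
  · intro h
    ext N
    exact ⟨fun hN P hP hX => hN P (hP.isWeaklyClosed hC) hX, fun hN => hN _ h (sigma_self X)⟩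

end Sigma

/-! ### Finiteness of Hom into X versus powers of X in σ[X] -/

section Finiteness

variable {C : Type u} [Category.{v} C] [Abelian C]

/-- Precomposition as a linear map over the endomorphism ring of the target. -/
def precompLinear {A B : C} (g : A ⟶ B) (X : C) : (B ⟶ X) →ₗ[End X] (A ⟶ X) where
  toFun h := g ≫ h
  map_add' := by simp
  map_smul' c h := (Category.assoc g h c).symm

@[simp]
theorem precompLinear_apply {A B : C} (g : A ⟶ B) (X : C) (h : B ⟶ X) :
    precompLinear g X h = g ≫ h := rfl

variable {P : ObjectProperty C} [P.IsSerreClass] {X : C}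

/-- For f ≠ 0, the inclusion of im f in X is an isomorphism modulo P, so by locality the map induced
by h on im f extends to X. -/
theorem CriticalFor.exists_comp_eq (hX : CriticalFor P X) (hloc : IsLocalFor P X) {A : C}
    (f h : A ⟶ X) (hfh : kernel.ι f ≫ h = 0) : ∃ k : X ⟶ X, f ≫ k = h := by
  by_cases hf : f = 0
  · refine ⟨0, ?_⟩
    subst hf
    rw [comp_zero, ← cancel_epi (kernel.ι (0 : A ⟶ X)), hfh, comp_zero]
  let e := Abelian.factorThruImage f
  let n := Abelian.image.ι f
  have hen : e ≫ n = f := Abelian.image.fac f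
  have h0 : kernel.ι e ≫ f = 0 := by
    have := kernel.condition e =≫ n
    rwa [Category.assoc, hen, zero_comp] at this
  have h1 : kernel.ι e ≫ h = 0 := by
    rw [← kernel.lift_ι f _ h0, Category.assoc, hfh, comp_zero]
  have hn : n ≠ 0 := fun h2 => hf (by rw [← hen, h2, comp_zero])
  obtain ⟨k, hk⟩ := hloc n (P.isoModSerre_of_mono n (hX.prop_cokernel n hn))
    (Abelian.epiDesc e h h1)
  refine ⟨k, ?_⟩
  rw [← hen, Category.assoc, hk]
  simp

theorem CriticalFor.exists_right_inverse (hX : CriticalFor P X) (hloc : IsLocalFor P X)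
    (f : X ⟶ X) (hf : f ≠ 0) : ∃ g : X ⟶ X, f ≫ g = 𝟙 X := by
  refine hX.exists_comp_eq hloc f (𝟙 X) ?_
  by_contra hk
  rw [Category.comp_id] at hk
  have h1 := hX.prop_image (kernel.ι f) hk f (kernel.condition f)
  apply hf
  rw [← Abelian.image.fac f, hX.eq_zero (Abelian.image.ι f) h1, comp_zero]

/-- A one-sided inverse of a nonzero map is itself nonzero and so has one too; hence all nonzero
endomorphisms are units. Noetherianity is what lets finiteness pass to submodules below. -/
theorem CriticalFor.isNoetherianRing_end (hX : CriticalFor P X) (hloc : IsLocalFor P X) :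
    IsNoetherianRing (End X) := by
  have h1 : 𝟙 X ≠ 0 := fun h =>
    hX.not_prop (P.prop_of_isZero ((IsZero.iff_id_eq_zero X).2 h))
  have hunit : ∀ f : End X, f ≠ 0 → IsUnit f := by
    intro f hf
    obtain ⟨g, hg⟩ := hX.exists_right_inverse hloc f hf
    have hg0 : g ≠ 0 := fun h => h1 (by rw [← hg, h, comp_zero])
    obtain ⟨k, hk⟩ := hX.exists_right_inverse hloc g hg0
    have hkf : k = f := by
      rw [← Category.id_comp k, ← hg, Category.assoc, hk, Category.comp_id]
    exact ⟨⟨f, g, by rw [End.mul_def, ← hkf, hk, End.one_def],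
      by rw [End.mul_def, hg, End.one_def]⟩, rfl⟩
  rw [isNoetherianRing_iff_ideal_fg]
  intro I
  by_cases hI : I = ⊥
  · rw [hI]; exact Submodule.fg_bot
  · obtain ⟨f, hfI, hf⟩ := Submodule.exists_mem_ne_zero_of_ne_bot hI
    rw [Ideal.eq_top_of_isUnit_mem I hfI (hunit f hf)]
    exact (Ideal.fg_top _)

theorem CriticalFor.finite_hom_of_jointly_mono (hX : CriticalFor P X) (hloc : IsLocalFor P X)
    (n : ℕ) : ∀ {A : C} (f : Fin n → (A ⟶ X)),
      (∀ {W : C} (x : W ⟶ A), (∀ i, x ≫ f i = 0) → x = 0) → Module.Finite (End X) (A ⟶ X) := by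
  have := hX.isNoetherianRing_end hloc
  induction n with
  | zero =>
    intro A f hf
    have : Subsingleton (A ⟶ X) := ⟨fun a b => by
      rw [← Category.id_comp a, ← Category.id_comp b, hf (𝟙 A) fun i => i.elim0, zero_comp,
        zero_comp]⟩
    infer_instance
  | succ n ih =>
    intro A f hf
    have hK : Module.Finite (End X) (kernel (f 0) ⟶ X) := by
      refine ih (fun i => kernel.ι (f 0) ≫ f i.succ) fun {W} x hx => ?_
      rw [← cancel_mono (kernel.ι (f 0)), zero_comp]
      refine hf _ (Fin.cases ?_ fun i => ?_)
      · simp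
      · simpa using hx i
    let φ := precompLinear (kernel.ι (f 0)) X
    -- Maps vanishing on ker (f 0) are multiples of f 0, so restriction to ker (f 0), where the
    -- other n maps are jointly mono, loses only a cyclic module.
    have hker : LinearMap.ker φ = Submodule.span (End X) {f 0} := by
      ext h
      rw [LinearMap.mem_ker, Submodule.mem_span_singleton]
      constructor
      · exact fun hh => hX.exists_comp_eq hloc (f 0) h hh
      · rintro ⟨k, rfl⟩
        rw [map_smul]
        simp [φ]
    refine ⟨Submodule.fg_of_fg_map_of_fg_inf_ker φ (IsNoetherian.noetherian _) ?_⟩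
    rw [top_inf_eq, hker]
    exact Submodule.fg_span_singleton _

variable [IsGrothendieckAbelian.{v} C]

theorem CriticalFor.homFinite_of_sigma (hC : LocallyNoetherian C) (hX : CriticalFor P X)
    (hloc : IsLocalFor P X) (N : C) [IsNoetherianObject N]
    (h : sigma X (∏ᶜ fun _ : N ⟶ X => X)) : HomFinite N X := by
  have := hX.isNoetherianRing_end hloc
  let p : N ⟶ ∏ᶜ fun _ : N ⟶ X => X := Pi.lift fun g => g
  have : IsNoetherianObject (Abelian.image p) :=
    isNoetherianObject_of_epi (Abelian.factorThruImage p)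
  obtain ⟨J, A, a, e, _, _⟩ :=
    (sigma_iff _ _).1 ((isWeaklyClosed_sigma X).sub (Abelian.image.ι p) h)
  obtain ⟨B, b, hB, hbe⟩ := exists_noetherian_epi hC e
  have : IsNoetherianObject (Abelian.image b) :=
    isNoetherianObject_of_epi (Abelian.factorThruImage b)
  have : Epi (Abelian.image.ι b ≫ e) := by
    have : Epi (Abelian.factorThruImage b ≫ Abelian.image.ι b ≫ e) := by
      rwa [← Category.assoc, Abelian.image.fac]
    exact epi_of_epi (Abelian.factorThruImage b) _
  let f := Abelian.image.ι b ≫ a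
  obtain ⟨s, hs⟩ := exists_finset_factorization _ f
  have hfin : Module.Finite (End X) (Abelian.image b ⟶ X) := by
    refine hX.finite_hom_of_jointly_mono hloc s.card
      (fun k => f ≫ sigmaProj (fun _ : J => X) (s.equivFin.symm k)) fun {W} x hx => ?_
    rw [← cancel_mono f, zero_comp, ← hs, Preadditive.comp_sum, Preadditive.comp_sum]
    refine Finset.sum_eq_zero fun j hj => ?_
    have := hx (s.equivFin ⟨j, hj⟩)
    rw [Equiv.symm_apply_apply] at this
    rw [← Category.assoc f, ← Category.assoc x, this, zero_comp]
  have hfin' : Module.Finite (End X) (Abelian.image p ⟶ X) :=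
    Module.Finite.of_injective (precompLinear (Abelian.image.ι b ≫ e) X)
      fun g g' hg => (cancel_epi (Abelian.image.ι b ≫ e)).1 hg
  rw [homFinite_iff]
  refine Module.Finite.of_surjective (precompLinear (Abelian.factorThruImage p) X) fun g =>
    ⟨Abelian.image.ι p ≫ Pi.π _ g, ?_⟩
  rw [precompLinear_apply, ← Category.assoc, Abelian.image.fac]
  simp [p]

theorem sigma_of_homFinite (N X : C) (h : HomFinite N X)
    (hmono : ∀ {W : C} (x : W ⟶ N), (∀ f : N ⟶ X, x ≫ f = 0) → x = 0) : sigma X N := by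
  obtain ⟨n, g, hg⟩ := h
  let F : ULift.{v} (Fin n) → C := fun _ => X
  let t : N ⟶ ∐ F := ∑ k, g k ≫ Sigma.ι F ⟨k⟩
  have ht (k : Fin n) : t ≫ sigmaProj F ⟨k⟩ = g k := by
    simp only [t, Preadditive.sum_comp, Category.assoc]
    rw [Finset.sum_eq_single k]
    · rw [ι_sigmaProj_self, Category.comp_id]
    · intro j _ hj
      rw [ι_sigmaProj_of_ne F (fun h => hj (ULift.up_injective h)), comp_zero]
    · exact fun h => (h (Finset.mem_univ _)).elim
  have : Mono t := by
    refine Preadditive.mono_of_cancel_zero _ fun x hx => hmono x fun f => ?_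
    obtain ⟨c, rfl⟩ := hg f
    rw [Preadditive.comp_sum]
    refine Finset.sum_eq_zero fun k _ => ?_
    rw [← ht, Category.assoc, ← Category.assoc, hx, zero_comp]
  have hs := isWeaklyClosed_sigma X
  exact hs.sub t (hs.coprod _ _ (colimit.isColimit _) fun _ => sigma_self X)

theorem sigma_pi_of_homFinite (hC : LocallyNoetherian C)
    (h : ∀ N : C, IsNoetherianObject N → HomFinite N X) (I : Type v) :
    sigma X (∏ᶜ fun _ : I => X) := by
  obtain ⟨K, G, hG, hsep⟩ := hC
  let Y := ∏ᶜ fun _ : I => X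
  have hs := isWeaklyClosed_sigma X
  let F : (Σ k, (G k ⟶ Y)) → C := fun z => Abelian.image z.2
  let p : ∐ F ⟶ Y := Sigma.desc fun z => Abelian.image.ι z.2
  have : Epi p := by
    refine Preadditive.epi_of_cancel_zero _ fun t ht => hsep _ _ ?_
    rintro _ ⟨k⟩ g
    have h1 : Abelian.image.ι g ≫ t = 0 := by
      have := Sigma.ι F ⟨k, g⟩ ≫= ht
      rwa [← Category.assoc, Sigma.ι_desc, comp_zero] at this
    rw [← Abelian.image.fac g, Category.assoc, h1, comp_zero, comp_zero]
  refine hs.quot p (hs.coprod _ _ (colimit.isColimit _) ?_)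
  rintro ⟨k, g⟩
  have := hG k
  have := isNoetherianObject_of_epi (Abelian.factorThruImage g)
  refine sigma_of_homFinite _ _ (h _ this) fun x hx => ?_
  rw [← cancel_mono (Abelian.image.ι g), zero_comp]
  refine Pi.hom_ext _ _ fun j => ?_
  rw [Category.assoc, hx, zero_comp]

end Finiteness

/-! ### The tininess criterion -/

section Main

variable {C : Type u} [Category.{v} C] [Abelian C] [IsGrothendieckAbelian.{v} C]

theorem isTiny_iff (hC : LocallyNoetherian C) (d : DimensionFunction.{v, u, o} C)
    (α : Ordinal.{o}) (hα : Order.IsSuccLimit α → DimLTClosedUnderSums d α)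
    (M : C) (hM : IsCritical d α M) (E : C) (i : M ⟶ E) (hi : IsInjectiveHull i) :
    IsTiny d α M ↔ ∀ I : Type v, sigma (tilde d α E : C) (∏ᶜ fun _ : I => (tilde d α E : C)) := by
  have hsum : ClosedUnderSums (dimLT d α) := dimLT_closedUnderSums d α hα
  obtain ⟨hX, ⟨m, hm, hcm⟩, hfac⟩ := tilde_spec hsum hM hi
  have := hi.mono
  have := hi.injective
  have hloc : IsLocalFor (dimLT d α) (tilde d α E : C) := isLocalFor_of_factors _ hX hfac
  have : Mono m := mono_of_mono_fac hm
  -- M ⟶ M̃ is mono with cokernel in P, so tininess of M can be tested on M̃.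
  have := Localization.inverts (quotientFunctor d α) _ m
    ((dimLT d α).isoModSerre_of_mono m hcm)
  let e := asIso ((quotientFunctor d α).map m)
  have h1 : IsTiny d α M ↔ IsTinySimple ((quotientFunctor d α).obj (tilde d α E : C)) :=
    ⟨fun h => IsTinySimple.of_iso h e, fun h => IsTinySimple.of_iso h e.symm⟩
  rw [h1, isTinySimple_quotient_iff hC hsum hX hloc]
  exact ⟨sigma_pi_of_homFinite hC, fun h N _ => hX.homFinite_of_sigma hC hloc N (h _)⟩

end Main

end NCSpace

theorem mainTheorem9 {C : Type u} [Category.{v} C] [Abelian C]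
    [IsGrothendieckAbelian.{v} C] (hC : NCSpace.LocallyNoetherian C)
    (d : NCSpace.DimensionFunction.{v, u, o} C) (α : Ordinal.{o})
    (hα : Order.IsSuccLimit α → NCSpace.DimLTClosedUnderSums d α)
    (M : C) (hM : NCSpace.IsCritical d α M)
    (E : C) (i : M ⟶ E) (hi : NCSpace.IsInjectiveHull i) :
    (NCSpace.IsTiny d α M ↔
      ∀ I : Type v, NCSpace.sigma (NCSpace.tilde d α E : C)
        (∏ᶜ fun _ : I => (NCSpace.tilde d α E : C))) ∧
    (AB4StarOfSize.{v} C →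
      (NCSpace.IsTiny d α M ↔
        NCSpace.sigma (NCSpace.tilde d α E : C) = NCSpace.pi (NCSpace.tilde d α E : C)) ∧
      (NCSpace.IsTiny d α M ↔
        NCSpace.IsClosedSubspace (NCSpace.sigma (NCSpace.tilde d α E : C)))) := by
  have htiny := NCSpace.isTiny_iff hC d α hα M hM E i hi
  refine ⟨htiny, fun _ => ?_⟩
  have hclosed : NCSpace.IsTiny d α M ↔
      NCSpace.IsClosedSubspace (NCSpace.sigma (NCSpace.tilde d α E : C)) := by
    rw [htiny]
    exact ⟨NCSpace.isClosedSubspace_sigma hC _, fun h _ =>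
      h.prod _ _ (limit.isLimit _) fun _ => NCSpace.sigma_self _⟩
  exact ⟨hclosed.trans (NCSpace.sigma_eq_pi_iff hC _).symm, hclosed⟩
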